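/- Let $R$ be an associative ring with identity; modules are unitary left $R$-modules. An $R$-module $N$ is called super finitely presented if there is an exact sequence $\cdots\to F_1\to F_0\to N\to 0$ in which each $F_i$ is a finitely generated projective $R$-module. The weak injective dimension of an $R$-module $M$ is the smallest integer $m\ge 0$ such that $\operatorname{Ext}_R^{m+1}(N,M)=0$ for every super finitely presented $R$-module $N$, and is $\infty$ if no such $m$ exists. For an integer $n\ge 0$, let $\mathcal{WI}_{\le n}$ be the class of all $R$-modules of weak injective dimension at most $n$. Theorem. For every integer $n\ge 0$, the class $\mathcal{WI}_{\le n}$ is preenveloping: every $R$-module $M$ has a $\mathcal{WI}_{\le n}$-preenvelope, that is, a homomorphism $\varphi\colon M\to W$ with $W\in\mathcal{WI}_{\le n}$ such that for every homomorphism $f\colon M\to W'$ with $W'\in\mathcal{WI}_{\le n}$ there is a homomorphism $g\colon W\to W'$ with $g\varphi=f$. -/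

import Mathlib

open CategoryTheory

universe u

/-- A left `R`-module `M` is super finitely presented if there is an exact sequence
`⋯ → F₁ → F₀ → M → 0` in which every `Fᵢ` is a finitely generated projective `R`-module. -/
def IsSuperFinitelyPresented {R : Type u} [Ring R] (M : ModuleCat.{u} R) : Prop :=
  ∃ (F : ℕ → ModuleCat.{u} R) (d : ∀ i, F (i + 1) →ₗ[R] F i) (ε : F 0 →ₗ[R] M),
    (∀ i, Module.Finite R (F i)) ∧ (∀ i, Module.Projective R (F i)) ∧
    Function.Surjective ε ∧ Function.Exact (d 0) ε ∧
    ∀ i, Function.Exact (d (i + 1)) (d i)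

/-- The weak injective dimension of `M`: the smallest natural number `n` such that
`Ext^{n+1}_R(N, M) = 0` for every super finitely presented `R`-module `N`, and `⊤` (infinity) if
there is no such `n` (the infimum of the empty set in `ℕ∞` is `⊤`). -/
noncomputable def weakInjectiveDimension {R : Type u} [Ring R] (M : ModuleCat.{u} R) : ℕ∞ :=
  sInf {m : ℕ∞ | ∃ n : ℕ, m = n ∧ ∀ N : ModuleCat.{u} R, IsSuperFinitelyPresented N →
    Subsingleton (Abelian.Ext.{u} N M (n + 1))}

/-- The class of left `R`-modules of weak injective dimension at most `n`. -/
def weakInjectiveDimensionLE (R : Type u) [Ring R] (n : ℕ) : ObjectProperty (ModuleCat.{u} R) :=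
  fun M => weakInjectiveDimension M ≤ n

/-- `φ : M ⟶ C` is a `𝒞`-preenvelope of `M`: `C` belongs to `𝒞`, and every morphism from `M` to a
member of `𝒞` factors through `φ`. -/
def IsPreenvelope {R : Type u} [Ring R] (𝒞 : ObjectProperty (ModuleCat.{u} R))
    {M C : ModuleCat.{u} R} (φ : M ⟶ C) : Prop :=
  𝒞 C ∧ ∀ (C' : ModuleCat.{u} R), 𝒞 C' → ∀ f : M ⟶ C', ∃ g : C ⟶ C', φ ≫ g = f

/-- A class `𝒞` of modules is preenveloping if every module has a `𝒞`-preenvelope. -/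
def IsPreenveloping {R : Type u} [Ring R] (𝒞 : ObjectProperty (ModuleCat.{u} R)) : Prop :=
  ∀ M : ModuleCat.{u} R, ∃ (C : ModuleCat.{u} R) (φ : M ⟶ C), IsPreenvelope 𝒞 φ

/-! Membership in the class is injectivity with respect to a set of monomorphisms. Shifting
dimension along syzygies and covering the last, finitely generated one by some `Rᵐ` turns vanishing
of `Ext^{n+1}(N, W)` into extending all maps `K ⟶ W` along an inclusion `K ≤ Rᵐ`
(`IsSuperFinitelyPresented.exists_submodule`). Unlike the modules `N`, the pairs `(m, K)` form a
type in universe `u`, so the small object argument factors `M ⟶ 0`; the first factor is the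
preenvelope. -/

/-- In a Grothendieck abelian category, every small family of monomorphisms permits the small
object argument. -/
lemma hasSmallObjectArgument_ofHoms_of_mono {C : Type*} [Category* C] [Abelian C]
    [IsGrothendieckAbelian.{u} C] {ι : Type u} {A B : ι → C} (i : ∀ a, A a ⟶ B a)
    [∀ a, Mono (i a)] : (MorphismProperty.ofHoms i).HasSmallObjectArgument.{u} := by
  -- With `κ` above the number of subobjects of each `A a`, the functor `Hom(A a, -)` commutes with
  -- `κ`-indexed colimits of monomorphisms.
  obtain ⟨κ, hκ', hκ⟩ := HasCardinalLT.exists_regular_cardinal_forall.{u} (fun a ↦ Subobject (A a))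
  have : Fact κ.IsRegular := ⟨hκ'⟩
  have : Nonempty κ.ord.ToType := by simpa using hκ'.ne_zero
  have := WellFoundedLT.toOrderBot κ.ord.ToType
  have hi : MorphismProperty.ofHoms i ≤ MorphismProperty.monomorphisms C := by
    rintro _ _ _ ⟨a⟩
    exact MorphismProperty.monomorphisms.infer_property _
  exact ⟨κ, inferInstance, inferInstance,
    { preservesColimit {X Y _ _} j hj f hf := by
        let hf' : (MorphismProperty.monomorphisms C).TransfiniteCompositionOfShape κ.ord.ToType f :=
          { toTransfiniteCompositionOfShape := hf.toTransfiniteCompositionOfShape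
            map_mem j hj := by
              have := (hf.attachCells j hj).pushouts_coproducts
              simp only [MorphismProperty.ofHoms_homFamily] at this
              refine (?_ : _ ≤ MorphismProperty.monomorphisms C) _ this
              simpa only [MorphismProperty.pushouts_le_iff, MorphismProperty.coproducts_le_iff] }
        have (j j' : κ.ord.ToType) (φ : j ⟶ j') : Mono (hf'.F.map φ) := hf'.mem_map φ
        obtain ⟨a⟩ := hj
        exact IsGrothendieckAbelian.preservesColimit_coyoneda_obj_of_mono (Y := hf'.F) (hκ a) }⟩

section

open Abelian

variable {R : Type u} [Ring R]

lemma IsSuperFinitelyPresented.finite {N : ModuleCat.{u} R} (hN : IsSuperFinitelyPresented N) :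
    Module.Finite R N := by
  obtain ⟨F, d, ε, hfin, -, hε, -⟩ := hN
  have := hfin 0
  exact Module.Finite.of_surjective ε hε

/-- A super finitely presented module has a super finitely presented syzygy. -/
lemma IsSuperFinitelyPresented.exists_shortExact {N : ModuleCat.{u} R}
    (hN : IsSuperFinitelyPresented N) :
    ∃ (K F : ModuleCat.{u} R) (f : K ⟶ F) (g : F ⟶ N) (w : f ≫ g = 0),
      (ShortComplex.mk f g w).ShortExact ∧ Projective F ∧ IsSuperFinitelyPresented K := by
  obtain ⟨F, d, ε, hfin, hproj, hε, hd, hdd⟩ := hN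
  have := hproj 0
  refine ⟨_, _, _, _, _, LinearMap.shortExact_shortComplexKer hε,
    (IsProjective.iff_projective (F 0)).1 inferInstance,
    fun i ↦ F (i + 1), fun i ↦ d (i + 1),
    (d 0).codRestrict (LinearMap.ker ε) fun x ↦ hd.apply_apply_eq_zero x,
    fun i ↦ hfin (i + 1), fun i ↦ hproj (i + 1), ?_, ?_, fun i ↦ hdd (i + 1)⟩
  · rintro ⟨x, hx⟩
    obtain ⟨y, rfl⟩ := (hd x).1 hx
    exact ⟨y, rfl⟩
  · intro x
    rw [← hdd 0 x]
    exact Subtype.ext_iff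

/-- Dimension shifting along a short exact sequence with projective middle term. -/
lemma subsingleton_ext_add_two_iff {S : ShortComplex (ModuleCat.{u} R)} (hS : S.ShortExact)
    [Projective S.X₂] (W : ModuleCat.{u} R) (n : ℕ) :
    Subsingleton (Ext.{u} S.X₃ W (n + 2)) ↔ Subsingleton (Ext.{u} S.X₁ W (n + 1)) := by
  refine ⟨fun h ↦ subsingleton_of_forall_eq 0 fun x ↦ ?_,
    fun h ↦ subsingleton_of_forall_eq 0 fun x ↦ ?_⟩
  · obtain ⟨y, rfl⟩ := Ext.contravariant_sequence_exact₁ hS W x (n₁ := n + 2) (by lia)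
      (Subsingleton.elim _ _)
    rw [Ext.eq_zero_of_projective y, Ext.comp_zero]
  · obtain ⟨y, rfl⟩ := Ext.contravariant_sequence_exact₃ hS W x
      (Ext.eq_zero_of_projective _) (n₀ := n + 1) (by lia)
    rw [Subsingleton.elim y 0, Ext.comp_zero]

/-- `Ext¹(S.X₃, W)` vanishes exactly when every map `S.X₁ ⟶ W` extends to the projective middle
term `S.X₂`. -/
lemma subsingleton_ext_one_iff {S : ShortComplex (ModuleCat.{u} R)} (hS : S.ShortExact)
    [Projective S.X₂] (W : ModuleCat.{u} R) :
    Subsingleton (Ext.{u} S.X₃ W 1) ↔ ∀ f : S.X₁ ⟶ W, ∃ g : S.X₂ ⟶ W, S.f ≫ g = f := by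
  refine ⟨fun h f ↦ ?_, fun h ↦ subsingleton_of_forall_eq 0 fun x ↦ ?_⟩
  · obtain ⟨y, hy⟩ := Ext.contravariant_sequence_exact₁ hS W (Ext.mk₀ f) (n₁ := 1) (by lia)
      (Subsingleton.elim _ _)
    obtain ⟨g, rfl⟩ := Ext.mk₀_bijective _ _ |>.2 y
    rw [Ext.mk₀_comp_mk₀] at hy
    exact ⟨g, (Ext.mk₀_bijective _ _).1 hy⟩
  · obtain ⟨y, rfl⟩ := Ext.contravariant_sequence_exact₃ hS W x
      (Ext.eq_zero_of_projective _) (n₀ := 0) (by lia)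
    obtain ⟨f, rfl⟩ := Ext.mk₀_bijective _ _ |>.2 y
    obtain ⟨g, rfl⟩ := h f
    -- Every class is a pushout of the extension class along some `f`; if `f` factors through `S.f`,
    -- it vanishes.
    rw [← Ext.mk₀_comp_mk₀, ← Ext.comp_assoc_of_third_deg_zero, hS.extClass_comp, Ext.zero_comp]

/-- The modules `W` to which every map from a submodule `K` of `Rᵐ` extends to `Rᵐ`. -/
def ExtendsFrom {m : ℕ} (K : Submodule R (Fin m → R)) : ObjectProperty (ModuleCat.{u} R) :=
  fun W ↦ ∀ f : ModuleCat.of R K ⟶ W, ∃ g : ModuleCat.of R (Fin m → R) ⟶ W,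
    ModuleCat.ofHom K.subtype ≫ g = f

/-- The choice of `K` depends on `N` and `n` only, never on `W`. -/
lemma IsSuperFinitelyPresented.exists_submodule {N : ModuleCat.{u} R}
    (hN : IsSuperFinitelyPresented N) (n : ℕ) :
    ∃ (m : ℕ) (K : Submodule R (Fin m → R)), ∀ W : ModuleCat.{u} R,
      Subsingleton (Ext.{u} N W (n + 1)) ↔ ExtendsFrom K W := by
  induction n generalizing N with
  | zero =>
    have := hN.finite
    obtain ⟨m, p, hp⟩ := Module.Finite.exists_fin' R N
    have : Projective (ModuleCat.of R (Fin m → R)) :=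
      (IsProjective.iff_projective (ModuleCat.of R (Fin m → R))).1 inferInstance
    exact ⟨m, LinearMap.ker p,
      fun W ↦ subsingleton_ext_one_iff (LinearMap.shortExact_shortComplexKer hp) W⟩
  | succ n ih =>
    obtain ⟨L, F, f, g, w, hS, hF, hL⟩ := hN.exists_shortExact
    obtain ⟨m, K, hK⟩ := ih hL
    exact ⟨m, K, fun W ↦ (subsingleton_ext_add_two_iff hS W n).trans (hK W)⟩

/-- Vanishing in one degree passes to the next because the syzygy `L` is again super finitely
presented. -/
lemma subsingleton_ext_of_le {W : ModuleCat.{u} R} {k n : ℕ} (hkn : k ≤ n)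
    (h : ∀ N : ModuleCat.{u} R, IsSuperFinitelyPresented N → Subsingleton (Ext.{u} N W (k + 1)))
    (N : ModuleCat.{u} R) (hN : IsSuperFinitelyPresented N) :
    Subsingleton (Ext.{u} N W (n + 1)) := by
  induction n, hkn using Nat.le_induction generalizing N with
  | base => exact h N hN
  | succ n _ ih =>
    obtain ⟨L, F, f, g, w, hS, hF, hL⟩ := hN.exists_shortExact
    exact (subsingleton_ext_add_two_iff hS W n).2 (ih L hL)

lemma weakInjectiveDimensionLE_iff (W : ModuleCat.{u} R) (n : ℕ) :
    weakInjectiveDimensionLE R n W ↔ ∀ N : ModuleCat.{u} R, IsSuperFinitelyPresented N →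
      Subsingleton (Ext.{u} N W (n + 1)) := by
  refine ⟨fun h ↦ ?_, fun h ↦ sInf_le ⟨n, rfl, h⟩⟩
  have hne : {m : ℕ∞ | ∃ n : ℕ, m = n ∧ ∀ N : ModuleCat.{u} R, IsSuperFinitelyPresented N →
      Subsingleton (Ext.{u} N W (n + 1))}.Nonempty := by
    -- An empty set would have infimum `⊤`, which is not at most `n`.
    by_contra! he
    have h : sInf _ ≤ (n : ℕ∞) := h
    rw [he, sInf_empty, top_le_iff] at h
    exact ENat.natCast_ne_top n h
  obtain ⟨k, hk, hkW⟩ := csInf_mem hne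
  refine subsingleton_ext_of_le (ENat.natCast_le_natCast.1 ?_) hkW
  rw [← hk]
  exact h

/-- The pairs `(m, K)` with `K ≤ Rᵐ` such that every module of weak injective dimension at most `n`
admits extensions of maps from `K` to `Rᵐ`. -/
def OrthogonalSubmodule (R : Type u) [Ring R] (n : ℕ) : Type u :=
  {p : Σ m : ℕ, Submodule R (Fin m → R) // weakInjectiveDimensionLE R n ≤ ExtendsFrom p.2}

lemma weakInjectiveDimensionLE_iff_extendsFrom (W : ModuleCat.{u} R) (n : ℕ) :
    weakInjectiveDimensionLE R n W ↔ ∀ p : OrthogonalSubmodule R n, ExtendsFrom p.1.2 W := by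
  refine ⟨fun h p ↦ p.2 W h, fun h ↦ (weakInjectiveDimensionLE_iff W n).2 fun N hN ↦ ?_⟩
  obtain ⟨m, K, hK⟩ := hN.exists_submodule n
  exact (hK W).2 (h ⟨⟨m, K⟩, fun W' hW' ↦
    (hK W').1 ((weakInjectiveDimensionLE_iff W' n).1 hW' N hN)⟩)

/-- The inclusions `K ⟶ Rᵐ` against which the modules of weak injective dimension at most `n` are
injective. -/
def orthogonalInclusions (R : Type u) [Ring R] (n : ℕ) : MorphismProperty (ModuleCat.{u} R) :=
  MorphismProperty.ofHoms fun p : OrthogonalSubmodule R n ↦ ModuleCat.ofHom p.1.2.subtype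

instance (n : ℕ) : (orthogonalInclusions R n).HasSmallObjectArgument.{u} := by
  have (p : OrthogonalSubmodule R n) : Mono (ModuleCat.ofHom p.1.2.subtype) :=
    (ModuleCat.mono_iff_injective _).2 p.1.2.injective_subtype
  exact hasSmallObjectArgument_ofHoms_of_mono _

/-- Over a zero object the lower triangle of a lifting square commutes automatically, so a lift is
just an extension. -/
lemma rlp_orthogonalInclusions_iff {W Z : ModuleCat.{u} R} (hZ : Limits.IsZero Z) (p : W ⟶ Z)
    (n : ℕ) : (orthogonalInclusions R n).rlp p ↔ weakInjectiveDimensionLE R n W := by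
  rw [weakInjectiveDimensionLE_iff_extendsFrom]
  constructor
  · intro h q f
    have := h _ (MorphismProperty.ofHoms.mk q)
    have sq : CommSq f (ModuleCat.ofHom q.1.2.subtype) p 0 := ⟨hZ.eq_of_tgt _ _⟩
    exact ⟨sq.lift, sq.fac_left⟩
  · rintro h _ _ _ ⟨q⟩
    refine ⟨fun {f _} sq ↦ ?_⟩
    obtain ⟨g, hg⟩ := h q f
    exact ⟨⟨⟨g, hg, hZ.eq_of_tgt _ _⟩⟩⟩

end

theorem mainTheorem3 (R : Type u) [Ring R] (n : ℕ) :
    IsPreenveloping (weakInjectiveDimensionLE R n) := by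
  intro M
  obtain ⟨Z, hZ⟩ := Limits.HasZeroObject.zero (C := ModuleCat.{u} R)
  let fac := MorphismProperty.factorizationData (orthogonalInclusions R n).rlp.llp
    (orthogonalInclusions R n).rlp (0 : M ⟶ Z)
  refine ⟨fac.Z, fac.i, (rlp_orthogonalInclusions_iff hZ fac.p n).1 fac.hp, fun W hW f ↦ ?_⟩
  have := fac.hi _ ((rlp_orthogonalInclusions_iff hZ (0 : W ⟶ Z) n).2 hW)
  have sq : CommSq f fac.i (0 : W ⟶ Z) 0 := ⟨hZ.eq_of_tgt _ _⟩
  exact ⟨sq.lift, sq.fac_left⟩
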